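/- **Setting.** Let $\mathcal V$ be a finite set with $n$ elements and $W$ a real symmetric $n\times n$ matrix with entries $W(x,y)\ge 0$, $x,y\in\mathcal V$. Let $\mathcal V=\mathcal B\cup\mathcal C$ be a partition into two disjoint non-empty parts, and let $\mathcal C$ be partitioned into $K\ge 1$ clusters $C_1,\dots,C_K$ of equal size; put $\delta=|\mathcal C|/n$. Let $W_0$ be $W$ with all entries between $\mathcal B$ and $\mathcal C$ replaced by $0$, let $E=W-W_0$, and for $t\in[0,1]$ let $$W(t)=W_0+tE,\qquad d(x,t)=\sum_{y\in\mathcal V}W(x,y;t),\qquad D(t)=\mathrm{diag}(d(\cdot,t)),\qquad P(t)=D(t)^{-1}W(t).$$ Write $\nu(A,0)=\sum_{x\in A}d(x,0)$, $\underline{d_0}=\min_x d(x,0)$, $\overline{d_0}=\max_x d(x,0)$, and assume $\underline{d_0}>0$. Let $$C=\sum_{x\in\mathcal B,\,y\in\mathcal C}W(x,y).$$ For every $t\in[0,1]$ let $\lambda_k(t)\in\mathbb R$ and $\psi_k(\cdot,t)\in\mathbb R^{\mathcal V}$, $k=1,\dots,n$, satisfy $$P(t)\psi_k(t)=\lambda_k(t)\psi_k(t),\qquad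 \psi_k(t)^TD(t)\psi_j(t)=\delta_{kj},$$ where the eigenvalues are indexed so that each $\lambda_k$ is continuous on $[0,1]$ (for instance, differentiable); no regularity in $t$ is required of the eigenvectors. For $I\subset\{1,\dots,n\}$ let $$S(x,t)=\sum_{k\in I}\psi_k(x,t)^2,\qquad \Delta(t)=\min_{i\in I,\,j\notin I}|\lambda_i(t)-\lambda_j(t)|$$ (with $\Delta(t)=+\infty$ if there is no such pair). **Assumption (A1).** At $t=0$: (a) $K$ of the eigenvectors $\psi_k(0)$, $k\in I$, are supported on $\mathcal C$, and the other $|I|-K$ are supported on $\mathcal B$. (b) For some $0\le\varepsilon_1<1$, and after applying some $K\times K$ orthogonal matrix to the $K$ eigenvectors with index in $I$ supported on $\mathcal C$, the resulting vectors $\tilde\psi_1,\dots,\tilde\psi_K$ satisfy, for each $j=1,\dots,K$, $$\frac{1-\varepsilon_1}{\nu(C_j,0)}\le\tilde\psi_j(x)^2\le\frac{1+\varepsilon_1}{\nu(C_j,0)}\quad\forall x\in C_j,\qquad \tilde\psi_j(x)^2\le\frac{\varepsilon_1}{\nu(\mathcal C,0)}\quad\forall x\in\mathcal C\setminus C_j.$$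 (c) For some $\varepsilon_2\ge 0$, each $\psi_k(0)$ with $k\in I$ that is supported on $\mathcal B$ satisfies $\psi_k(x,0)^2\le\frac{1+\varepsilon_2}{\nu(\mathcal B,0)}$ for all $x\in\mathcal B$. **Assumption (A2).** $$\frac{\delta}{1-\delta}\,\frac{|I|-K}{K}<\frac{\underline{d_0}\,(1-\varepsilon_1)}{\overline{d_0}\,(1+\varepsilon_2)}.$$ Put $$(\#)=\frac{\underline{d_0}(1-\varepsilon_1)}{\overline{d_0}}-\frac{\delta}{1-\delta}\,\frac{|I|-K}{K}\,(1+\varepsilon_2),$$ which is positive by (A2). **Theorem (Separation at $t=1$).** Assume (A1) and (A2), and suppose that for some constant $\Delta>0$ (i) $\Delta(0)\ge 2\Delta$, and (ii) $\displaystyle\frac{C}{\underline{d_0}}\le\frac{\Delta}{8}\,\frac{1}{1+\frac{\Delta}{4}}\,\log\Bigl(1+\frac12\cdot\frac{(\#)}{1+2\varepsilon_1}\Bigr).$ Then there is a constant $\tau$ such that $$S(x,1)>\tau\quad\forall x\in\mathcal C,\qquad S(x,1)<\tau\quad\forall x\in\mathcal B.$$ -/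

import Mathlib

noncomputable section

namespace EmbeddingNorm

variable {V : Type*} [Fintype V] [DecidableEq V]

/-- `W` with all the connections between `B` and `C` removed. -/
def blockPart (W : Matrix V V ℝ) (B C : Finset V) : Matrix V V ℝ :=
  Matrix.of fun x y => if (x ∈ B ∧ y ∈ C) ∨ (x ∈ C ∧ y ∈ B) then 0 else W x y

/-- The deformation `W(t) = W₀ + t E`, where `E = W - W₀`. -/
def deform (W : Matrix V V ℝ) (B C : Finset V) (t : ℝ) : Matrix V V ℝ :=
  blockPart W B C + t • (W - blockPart W B C)

/-- The degree `d(x) = ∑ y, W(x, y)`. -/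
def degree (W : Matrix V V ℝ) (x : V) : ℝ := ∑ y, W x y

/-- The diagonal degree matrix `D`. -/
def degreeMatrix (W : Matrix V V ℝ) : Matrix V V ℝ := Matrix.diagonal (degree W)

/-- The Markov matrix `P = D⁻¹ W`. -/
def markov (W : Matrix V V ℝ) : Matrix V V ℝ := (degreeMatrix W)⁻¹ * W

/-- The volume `ν(A) = ∑ x ∈ A, d(x)`. -/
def vol (W : Matrix V V ℝ) (A : Finset V) : ℝ := ∑ x ∈ A, degree W x

/-- The least degree (a minimum, as `V` is finite). -/
def minDegree (W : Matrix V V ℝ) : ℝ := ⨅ x, degree W x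

/-- The largest degree. -/
def maxDegree (W : Matrix V V ℝ) : ℝ := ⨆ x, degree W x

/-- The connection strength between `B` and `C`. -/
def connection (W : Matrix V V ℝ) (B C : Finset V) : ℝ := ∑ x ∈ B, ∑ y ∈ C, W x y

/-- The fraction of the nodes that lie in `C`. -/
def fraction (C : Finset V) : ℝ := (C.card : ℝ) / (Fintype.card V : ℝ)

/-- A system of `n` eigenpairs of `P = D⁻¹ W`, with `P ψₖ = λₖ ψₖ` and `ψₖᵀ D ψⱼ = δₖⱼ`;
it is complete when `n = |V|`. -/
structure IsEigenSystem (W : Matrix V V ℝ) {n : ℕ} (lam : Fin n → ℝ)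
    (ψ : Fin n → V → ℝ) : Prop where
  eigen : ∀ k, (markov W).mulVec (ψ k) = lam k • ψ k
  orthonormal : ∀ k j, ψ k ⬝ᵥ (degreeMatrix W).mulVec (ψ j) = if k = j then 1 else 0

/-- The spectral embedding norm `S(x) = ∑ k ∈ I, ψₖ(x)²`. -/
def embNorm {n : ℕ} (ψ : Fin n → V → ℝ) (I : Finset (Fin n)) (x : V) : ℝ :=
  ∑ k ∈ I, ψ k x ^ 2

/-- The `I`-eigen-gap `min |λᵢ - λⱼ|` over `i ∈ I`, `j ∉ I`; the minimum over the empty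
family is `⊤`. -/
def eigenGap {n : ℕ} (lam : Fin n → ℝ) (I : Finset (Fin n)) : EReal :=
  ⨅ i ∈ I, ⨅ j ∈ Iᶜ, ((|lam i - lam j| : ℝ) : EReal)

/-- The indices in `I` of the eigenvectors that are supported on `A`. -/
def supportedIndices {n : ℕ} (ψ : Fin n → V → ℝ) (I : Finset (Fin n)) (A : Finset V) :
    Set (Fin n) :=
  {k | k ∈ I ∧ ∀ x, x ∉ A → ψ k x = 0}

/-- The node set is split into the background `B` and the cluster part `C`, and `C` is split
into `K` clusters `Cl j` of equal size. -/
structure IsSplitting (B C : Finset V) {K : ℕ} (Cl : Fin K → Finset V) : Prop where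
  disjoint : Disjoint B C
  union : B ∪ C = Finset.univ
  cluster_disjoint : ∀ i j, i ≠ j → Disjoint (Cl i) (Cl j)
  cluster_union : Finset.univ.biUnion Cl = C
  cluster_card : ∀ j, ((Cl j).card : ℝ) = (C.card : ℝ) / (K : ℝ)

/-- The assumption on the eigenvectors `ψ` of the decoupled graph `W₀` and on the index
set `I`. -/
structure EigenvectorAssumption (W₀ : Matrix V V ℝ) (B C : Finset V) {K : ℕ}
    (Cl : Fin K → Finset V) {n : ℕ} (ψ : Fin n → V → ℝ) (I : Finset (Fin n))
    (ε₁ ε₂ : ℝ) : Prop where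
  /-- `I` consists of `K` eigenvectors supported on `C` and `|I| - K` supported on `B`. -/
  count_C : (supportedIndices ψ I C).ncard = K
  count_B : (supportedIndices ψ I B).ncard + K = I.card
  /-- Up to a `K × K` orthogonal matrix, the `K` eigenvectors on `C` are associated
  with the `K` clusters, one with each. -/
  eps₁_nonneg : 0 ≤ ε₁
  eps₁_lt_one : ε₁ < 1
  clustered : ∃ (e : Fin K ≃ supportedIndices ψ I C),
    ∃ Q ∈ Matrix.orthogonalGroup (Fin K) ℝ, ∀ j,
      (∀ x ∈ Cl j,
        (1 - ε₁) / vol W₀ (Cl j) ≤ (∑ i, Q j i * ψ (e i) x) ^ 2 ∧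
        (∑ i, Q j i * ψ (e i) x) ^ 2 ≤ (1 + ε₁) / vol W₀ (Cl j)) ∧
      (∀ x ∈ C \ Cl j, (∑ i, Q j i * ψ (e i) x) ^ 2 ≤ ε₁ / vol W₀ C)
  /-- The eigenvectors in `I` that are supported on `B` are flat. -/
  eps₂_nonneg : 0 ≤ ε₂
  flat : ∀ k ∈ supportedIndices ψ I B, ∀ x ∈ B, ψ k x ^ 2 ≤ (1 + ε₂) / vol W₀ B

/-- The assumption on `δ`, `|I|` and `K`; here `m = |I|`. -/
def ProportionAssumption (W₀ : Matrix V V ℝ) (C : Finset V) (K m : ℕ) (ε₁ ε₂ : ℝ) : Prop :=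
  fraction C / (1 - fraction C) * (((m : ℝ) - (K : ℝ)) / (K : ℝ)) <
    minDegree W₀ * (1 - ε₁) / (maxDegree W₀ * (1 + ε₂))

/-- The normalized initial gap `(#)`; here `m = |I|`. -/
def sharp (W₀ : Matrix V V ℝ) (C : Finset V) (K m : ℕ) (ε₁ ε₂ : ℝ) : ℝ :=
  minDegree W₀ * (1 - ε₁) / maxDegree W₀ -
    fraction C / (1 - fraction C) * (((m : ℝ) - (K : ℝ)) / (K : ℝ)) * (1 + ε₂)

end EmbeddingNorm

end

set_option linter.unusedSectionVars false

namespace EmbeddingNorm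

variable {V : Type*} [Fintype V] [DecidableEq V] {n : ℕ}

/-! The graphs at `t = 0` and `t = 1` are compared directly, without differentiating in `t`, so
eigenvectors at intermediate times enter only through bounds on their eigenvalues.

Expand each eigenvector with index in `I` at one time in the eigenbasis of the other
(`embNorm_sub_eq`). The `I × I` blocks of the two expansions of `S` nearly cancel, leaving a term in
the change of degrees. In the `I × Iᶜ` blocks, `cross_identity` writes each coefficient as a matrix
element of the perturbed pencil divided by an eigenvalue difference. The pencil perturbation has
total entry mass at most `4c`, with `c` the connection strength, and `S ≤ 1/d₀` for any index set;
hence, with `g` the gap between the two spectra and `m`, `m'` the maxima of `S` at the two times,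
the change of `S` is at most `c/d₀ * (4/g + 1/2) * (m + m')` (`abs_embNorm_sub_le`).

The gap comes from `exists_eigenvalue_near` (each eigenvalue at time `t` lies within `2c/d₀` of the
initial spectrum) and `gap_of_near_initial` (by continuity no branch can jump from one group of
initial eigenvalues to the other). Finally `initial_embNorm_bounds` shows that at `t = 0` the values
on `C` exceed those on `B` by a multiple of `(#)`. The connection hypothesis makes the change less
than half of this margin. -/

theorem degreeMatrix_mulVec (W : Matrix V V ℝ) (v : V → ℝ) (x : V) :
    (degreeMatrix W).mulVec v x = degree W x * v x := by
  simp [degreeMatrix, Matrix.mulVec_diagonal]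

theorem degree_sub (A A' : Matrix V V ℝ) (x : V) :
    degree (A' - A) x = degree A' x - degree A x := by
  simp [degree, Finset.sum_sub_distrib]

theorem minDegree_le (W : Matrix V V ℝ) (x : V) : minDegree W ≤ degree W x :=
  ciInf_le (Set.finite_range _).bddBelow x

theorem le_maxDegree (W : Matrix V V ℝ) (x : V) : degree W x ≤ maxDegree W :=
  le_ciSup (Set.finite_range _).bddAbove x

/-! ### Orthogonality, completeness and spectral bounds for one eigensystem. -/

section System

variable {W : Matrix V V ℝ} {lam : Fin n → ℝ} {ψ : Fin n → V → ℝ}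

theorem IsEigenSystem.sum_degree_mul (h : IsEigenSystem W lam ψ) (k j : Fin n) :
    ∑ x, degree W x * ψ k x * ψ j x = if k = j then 1 else 0 := by
  rw [← h.orthonormal k j, dotProduct]
  exact Finset.sum_congr rfl fun x _ => by rw [degreeMatrix_mulVec]; ring

theorem IsEigenSystem.mulVec_eq (h : IsEigenSystem W lam ψ) (hd : ∀ x, 0 < degree W x)
    (k : Fin n) (x : V) : ∑ y, W x y * ψ k y = lam k * (degree W x * ψ k x) := by
  have hdet : IsUnit (degreeMatrix W).det := by
    rw [degreeMatrix, Matrix.det_diagonal]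
    exact (Finset.prod_pos fun x _ => hd x).ne'.isUnit
  have h1 : W.mulVec (ψ k) = (degreeMatrix W).mulVec (lam k • ψ k) := by
    rw [← h.eigen k, markov, Matrix.mulVec_mulVec, ← mul_assoc, Matrix.mul_nonsing_inv _ hdet,
      one_mul]
  have h2 := congrFun h1 x
  rw [degreeMatrix_mulVec] at h2
  simp only [Matrix.mulVec, dotProduct, Pi.smul_apply, smul_eq_mul] at h2
  rw [h2]; ring

/-- Orthonormality exhibits a left inverse of the matrix of eigenvectors; as `n = |V|`, it is also a
right inverse. -/
theorem IsEigenSystem.sum_mul (h : IsEigenSystem W lam ψ) (hn : Fintype.card V = n)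
    (hd : ∀ x, 0 < degree W x) (x y : V) :
    ∑ k, ψ k x * ψ k y = if x = y then (degree W x)⁻¹ else 0 := by
  let Ψ : Matrix V (Fin n) ℝ := Matrix.of fun x k => ψ k x
  let Φ : Matrix (Fin n) V ℝ := Matrix.of fun k x => degree W x * ψ k x
  have h1 : Φ * Ψ = 1 := by
    ext k j
    rw [Matrix.mul_apply, Matrix.one_apply]
    exact h.sum_degree_mul k j
  have h2 : Ψ * Φ = 1 := (Matrix.mul_eq_one_comm_of_card_eq _ _ _ (by simp [hn])).1 h1
  have h3 := congrFun (congrFun h2 y) x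
  rw [Matrix.mul_apply, Matrix.one_apply] at h3
  have h4 : (∑ k, ψ k x * ψ k y) * degree W x = if y = x then 1 else 0 := by
    rw [← h3, Finset.sum_mul]
    exact Finset.sum_congr rfl fun k _ => by simp [Ψ, Φ]; ring
  have hx := (hd x).ne'
  rw [← mul_right_cancel_iff_of_pos (hd x), h4]
  by_cases hxy : x = y
  · subst hxy; simp [hx]
  · simp [hxy, Ne.symm hxy]

theorem IsEigenSystem.sum_coeff_mul (h : IsEigenSystem W lam ψ) (hn : Fintype.card V = n)
    (hd : ∀ x, 0 < degree W x) (v : V → ℝ) (x : V) :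
    ∑ k, (∑ u, degree W u * ψ k u * v u) * ψ k x = v x := by
  have : ∑ k, (∑ u, degree W u * ψ k u * v u) * ψ k x =
      ∑ u, (∑ k, ψ k u * ψ k x) * (degree W u * v u) := by
    simp_rw [Finset.sum_mul]
    rw [Finset.sum_comm]
    exact Finset.sum_congr rfl fun u _ => Finset.sum_congr rfl fun k _ => by ring
  rw [this]
  simp_rw [h.sum_mul hn hd]
  simp [(hd x).ne']

/-- Parseval in dual form: the pairing carries no weight `D`, so `D⁻¹` appears on the right. -/
theorem IsEigenSystem.sum_sq_dotProduct (h : IsEigenSystem W lam ψ) (hn : Fintype.card V = n)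
    (hd : ∀ x, 0 < degree W x) (v : V → ℝ) :
    ∑ k, (∑ u, ψ k u * v u) ^ 2 = ∑ u, (degree W u)⁻¹ * v u ^ 2 := by
  have : ∑ k, (∑ u, ψ k u * v u) ^ 2 = ∑ u, ∑ w, (∑ k, ψ k u * ψ k w) * (v u * v w) := by
    simp_rw [sq, Finset.sum_mul_sum, Finset.sum_mul]
    rw [Finset.sum_comm]
    refine Finset.sum_congr rfl fun u _ => ?_
    rw [Finset.sum_comm]
    exact Finset.sum_congr rfl fun w _ => Finset.sum_congr rfl fun k _ => by ring
  rw [this]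
  simp_rw [h.sum_mul hn hd]
  simp [sq]

theorem IsEigenSystem.embNorm_le (h : IsEigenSystem W lam ψ) (hn : Fintype.card V = n)
    (hd : ∀ x, 0 < degree W x) (I : Finset (Fin n)) (x : V) :
    embNorm ψ I x ≤ (degree W x)⁻¹ := by
  have := h.sum_mul hn hd x x
  rw [if_pos rfl] at this
  rw [← this]
  simp_rw [← sq]
  exact Finset.sum_le_univ_sum_of_nonneg fun k => sq_nonneg _

/-- Maximum principle: evaluate the eigenvalue equation where `|ψ k|` is largest. -/
theorem IsEigenSystem.abs_le_one (h : IsEigenSystem W lam ψ) (hd : ∀ x, 0 < degree W x)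
    (hW : ∀ x y, 0 ≤ W x y) (k : Fin n) : |lam k| ≤ 1 := by
  have hne : ∃ x, ψ k x ≠ 0 := by
    by_contra! h0
    have := h.sum_degree_mul k k
    simp [h0] at this
  obtain ⟨x₀, hx₀⟩ := hne
  obtain ⟨x, -, hx⟩ := Finset.exists_max_image Finset.univ (fun x => |ψ k x|) ⟨x₀, by simp⟩
  have hpos : 0 < |ψ k x| := (abs_pos.2 hx₀).trans_le (hx x₀ (by simp))
  have h1 : |lam k| * (degree W x * |ψ k x|) ≤ 1 * (degree W x * |ψ k x|) := by
    calc |lam k| * (degree W x * |ψ k x|) = |∑ y, W x y * ψ k y| := by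
          rw [h.mulVec_eq hd, abs_mul, abs_mul, abs_of_pos (hd x)]
      _ ≤ ∑ y, |W x y * ψ k y| := Finset.abs_sum_le_sum_abs _ _
      _ ≤ ∑ y, W x y * |ψ k x| := Finset.sum_le_sum fun y _ => by
          rw [abs_mul, abs_of_nonneg (hW x y)]
          exact mul_le_mul_of_nonneg_left (hx y (by simp)) (hW x y)
      _ = _ := by rw [← Finset.sum_mul, one_mul]; rfl
  exact le_of_mul_le_mul_right h1 (mul_pos (hd x) hpos)

/-- The orthogonality of the eigenvectors makes `∑ k ∈ I, ψₖ ψₖᵀ D` a projection. -/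
theorem IsEigenSystem.sum_degree_mul_kernel_sq (h : IsEigenSystem W lam ψ) (I : Finset (Fin n))
    (x : V) : ∑ u, degree W u * (∑ k ∈ I, ψ k x * ψ k u) ^ 2 = embNorm ψ I x := by
  have : ∑ u, degree W u * (∑ k ∈ I, ψ k x * ψ k u) ^ 2 =
      ∑ k ∈ I, ∑ j ∈ I, ψ k x * ψ j x * ∑ u, degree W u * ψ k u * ψ j u := by
    simp_rw [sq, Finset.sum_mul_sum, Finset.mul_sum]
    rw [Finset.sum_comm]
    refine Finset.sum_congr rfl fun k _ => ?_
    rw [Finset.sum_comm]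
    exact Finset.sum_congr rfl fun j _ => Finset.sum_congr rfl fun u _ => by ring
  rw [this, embNorm]
  simp_rw [h.sum_degree_mul]
  refine Finset.sum_congr rfl fun k hk => ?_
  simp [hk, sq]

end System

/-! ### Perturbation of the pencil `A - λ D`. -/

section Perturbation

variable {A A' : Matrix V V ℝ} {lam lam' : Fin n → ℝ} {ψ φ : Fin n → V → ℝ}

/-- Pair `A'` with `φ j` and `ψ k`, moving it onto `φ j` by symmetry, and subtract the pairing of
`A`. The degree part of the perturbation turns the weight `D` into `D'`, so a single factor `lam' j
- lam k` comes out. -/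
theorem cross_identity (hA' : A'.IsSymm) (h : IsEigenSystem A lam ψ)
    (h' : IsEigenSystem A' lam' φ) (hd : ∀ x, 0 < degree A x) (hd' : ∀ x, 0 < degree A' x)
    (j k : Fin n) :
    (lam' j - lam k) * ∑ u, degree A' u * φ j u * ψ k u =
      ∑ u, φ j u * ∑ v, ((A' - A) - lam k • degreeMatrix (A' - A)) u v * ψ k v := by
  have e1 : ∑ u, φ j u * ∑ v, A' u v * ψ k v =
      lam' j * ∑ u, degree A' u * φ j u * ψ k u := by
    have : ∑ u, φ j u * ∑ v, A' u v * ψ k v = ∑ v, (∑ u, A' v u * φ j u) * ψ k v := by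
      simp_rw [Finset.mul_sum, Finset.sum_mul]
      rw [Finset.sum_comm]
      refine Finset.sum_congr rfl fun v _ => Finset.sum_congr rfl fun u _ => ?_
      rw [hA'.apply v u]; ring
    rw [this, Finset.mul_sum]
    exact Finset.sum_congr rfl fun v _ => by rw [h'.mulVec_eq hd']; ring
  have e2 : ∑ u, φ j u * ∑ v, A u v * ψ k v =
      lam k * ∑ u, degree A u * φ j u * ψ k u := by
    rw [Finset.mul_sum]
    exact Finset.sum_congr rfl fun v _ => by rw [h.mulVec_eq hd]; ring
  have e3 : ∀ u, ∑ v, ((A' - A) - lam k • degreeMatrix (A' - A)) u v * ψ k v =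
      ∑ v, A' u v * ψ k v - ∑ v, A u v * ψ k v
        - lam k * ((degree A' u - degree A u) * ψ k u) := by
    intro u
    have := degreeMatrix_mulVec (A' - A) (ψ k) u
    rw [degree_sub] at this
    rw [← this]
    simp only [Matrix.mulVec, dotProduct, Finset.mul_sum, ← Finset.sum_sub_distrib]
    exact Finset.sum_congr rfl fun v _ => by simp [Matrix.sub_apply, Matrix.smul_apply]; ring
  have e4 : ∑ u, φ j u * (lam k * ((degree A' u - degree A u) * ψ k u)) =
      lam k * ∑ u, degree A' u * φ j u * ψ k u - lam k * ∑ u, degree A u * φ j u * ψ k u := by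
    simp_rw [Finset.mul_sum]
    rw [← Finset.sum_sub_distrib]
    exact Finset.sum_congr rfl fun u _ => by ring
  simp_rw [e3]
  simp_rw [mul_sub (φ j _), Finset.sum_sub_distrib]
  rw [e1, e2, e4]
  ring

/-- Entrywise bound on the perturbation of the pencil `A - λ D` by `E`, for `|λ| ≤ 1`. -/
def envelope (E : Matrix V V ℝ) : Matrix V V ℝ := E + degreeMatrix E

theorem abs_pencil_le {R E : Matrix V V ℝ} (hR : ∀ u v, |R u v| ≤ E u v) {l : ℝ} (hl : |l| ≤ 1)
    (u v : V) : |(R - l • degreeMatrix R) u v| ≤ envelope E u v := by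
  have h1 : |degree R u| ≤ degree E u :=
    (Finset.abs_sum_le_sum_abs _ _).trans (Finset.sum_le_sum fun y _ => hR u y)
  have h2 : |(degreeMatrix R) u v| ≤ degreeMatrix E u v := by
    by_cases huv : u = v
    · subst huv; simpa [degreeMatrix] using h1
    · simp [degreeMatrix, huv]
  calc |(R - l • degreeMatrix R) u v| ≤ |R u v| + |l * degreeMatrix R u v| := by
        simp only [Matrix.sub_apply, Matrix.smul_apply, smul_eq_mul]
        exact abs_sub _ _
    _ ≤ E u v + 1 * degreeMatrix E u v := by
        rw [abs_mul]
        gcongr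
        exact hR u v
    _ = _ := by simp [envelope]

theorem envelope_row (E : Matrix V V ℝ) (u : V) : ∑ v, envelope E u v = 2 * degree E u := by
  simp [envelope, degreeMatrix, Finset.sum_add_distrib, Matrix.diagonal_apply, degree, two_mul]

theorem envelope_symm {E : Matrix V V ℝ} (hE : E.IsSymm) (u v : V) :
    envelope E u v = envelope E v u := by
  have : (envelope E).IsSymm := hE.add (Matrix.isSymm_diagonal _)
  exact this.apply v u

end Perturbation

/-! ### Stability of eigenvalues and of the embedding norm. -/

section Perturbation

variable {A A' E : Matrix V V ℝ} {lam lam' : Fin n → ℝ} {ψ φ : Fin n → V → ℝ}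

/-- Schur's test for a matrix with a symmetric entrywise bound. -/
theorem sum_sq_mulVec_le {M N : Matrix V V ℝ} (hM : ∀ u v, |M u v| ≤ N u v)
    (hN : ∀ u v, N u v = N v u) {r : ℝ} (hr : ∀ u, ∑ v, N u v ≤ r) (f : V → ℝ) :
    ∑ u, (∑ v, M u v * f v) ^ 2 ≤ r ^ 2 * ∑ v, f v ^ 2 := by
  have hN0 : ∀ u v, 0 ≤ N u v := fun u v => (abs_nonneg _).trans (hM u v)
  have h1 : ∀ u, (∑ v, M u v * f v) ^ 2 ≤ r * ∑ v, N u v * f v ^ 2 := by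
    intro u
    have h2 : |∑ v, M u v * f v| ≤ ∑ v, N u v * |f v| :=
      (Finset.abs_sum_le_sum_abs _ _).trans (Finset.sum_le_sum fun v _ => by
        rw [abs_mul]
        exact mul_le_mul_of_nonneg_right (hM u v) (abs_nonneg _))
    calc (∑ v, M u v * f v) ^ 2 = |∑ v, M u v * f v| ^ 2 := (sq_abs _).symm
      _ ≤ (∑ v, N u v * |f v|) ^ 2 := by gcongr
      _ ≤ (∑ v, N u v) * ∑ v, N u v * f v ^ 2 :=
        Finset.sum_sq_le_sum_mul_sum_of_sq_le_mul _ (fun v _ => hN0 u v)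
          (fun v _ => mul_nonneg (hN0 u v) (sq_nonneg _))
          (fun v _ => le_of_eq (by rw [mul_pow, sq_abs]; ring))
      _ ≤ r * ∑ v, N u v * f v ^ 2 :=
        mul_le_mul_of_nonneg_right (hr u)
          (Finset.sum_nonneg fun v _ => mul_nonneg (hN0 u v) (sq_nonneg _))
  have hr0 : ∀ u : V, 0 ≤ r := fun u => (Finset.sum_nonneg fun v _ => hN0 u v).trans (hr u)
  calc ∑ u, (∑ v, M u v * f v) ^ 2 ≤ ∑ u, r * ∑ v, N u v * f v ^ 2 :=
        Finset.sum_le_sum fun u _ => h1 u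
    _ = ∑ v, r * ((∑ u, N v u) * f v ^ 2) := by
        simp_rw [Finset.sum_mul, Finset.mul_sum]
        rw [Finset.sum_comm]
        exact Finset.sum_congr rfl fun v _ => Finset.sum_congr rfl fun u _ => by rw [hN u v]
    _ ≤ ∑ v, r * (r * f v ^ 2) := Finset.sum_le_sum fun v _ =>
        mul_le_mul_of_nonneg_left (mul_le_mul_of_nonneg_right (hr v) (sq_nonneg _)) (hr0 v)
    _ = _ := by rw [Finset.mul_sum]; exact Finset.sum_congr rfl fun v _ => by ring

/-- Every eigenvalue of the first system is close to an eigenvalue of the second one. -/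
theorem exists_eigenvalue_near (hn : Fintype.card V = n) (hA' : A'.IsSymm) (hE : E.IsSymm)
    (hR : ∀ u v, |(A' - A) u v| ≤ E u v)
    (h : IsEigenSystem A lam ψ) (h' : IsEigenSystem A' lam' φ) {d₀ c : ℝ} (hd₀ : 0 < d₀)
    (hd : ∀ x, d₀ ≤ degree A x) (hd' : ∀ x, d₀ ≤ degree A' x) (hc : ∀ x, degree E x ≤ c)
    (k : Fin n) (hk : |lam k| ≤ 1) :
    ∃ j, |lam' j - lam k| ≤ 2 * c / d₀ := by
  have hdp : ∀ x, 0 < degree A x := fun x => hd₀.trans_le (hd x)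
  have hdp' : ∀ x, 0 < degree A' x := fun x => hd₀.trans_le (hd' x)
  have hne : ∃ x, ψ k x ≠ 0 := by
    by_contra! h0
    have := h.sum_degree_mul k k
    simp [h0] at this
  obtain ⟨x, hx⟩ := hne
  have hc0 : 0 ≤ c := le_trans (Finset.sum_nonneg fun y _ => (abs_nonneg _).trans (hR x y)) (hc x)
  by_contra! hcon
  -- `y` is the residual of `ψ k` in the pencil of `A'`, and `a` holds its coefficients in the basis
  -- `φ`. If every eigenvalue were far away, the residual would exceed the bound from Schur's test.
  set y : V → ℝ := fun u =>
    ∑ v, ((A' - A) - lam k • degreeMatrix (A' - A)) u v * ψ k v with hy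
  set a : Fin n → ℝ := fun j => ∑ u, degree A' u * φ j u * ψ k u with ha
  have hid : ∀ j, (lam' j - lam k) * a j = ∑ u, φ j u * y u := fun j =>
    cross_identity hA' h h' hdp hdp' j k
  have ha2 : ∑ j, a j ^ 2 = ∑ u, degree A' u * ψ k u ^ 2 := by
    have := h'.sum_sq_dotProduct hn hdp' (fun u => degree A' u * ψ k u)
    convert this using 2 with j _ u _
    · rw [ha]; congr 1; exact Finset.sum_congr rfl fun u _ => by ring
    · have := (hdp' u).ne'
      field_simp
  have hψ : 0 < ∑ u, ψ k u ^ 2 :=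
    Finset.sum_pos' (fun u _ => sq_nonneg _) ⟨x, Finset.mem_univ _, by positivity⟩
  have hlow : d₀ * ∑ u, ψ k u ^ 2 ≤ ∑ j, a j ^ 2 := by
    rw [ha2, Finset.mul_sum]
    exact Finset.sum_le_sum fun u _ => mul_le_mul_of_nonneg_right (hd' u) (sq_nonneg _)
  have hapos : 0 < ∑ j, a j ^ 2 := (mul_pos hd₀ hψ).trans_le hlow
  have hyb : ∑ u, y u ^ 2 ≤ (2 * c) ^ 2 * ∑ u, ψ k u ^ 2 :=
    sum_sq_mulVec_le (abs_pencil_le hR hk) (envelope_symm hE)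
      (fun u => by rw [envelope_row]; linarith [hc u]) _
  have hup : ∑ j, ((lam' j - lam k) * a j) ^ 2 ≤ d₀⁻¹ * ((2 * c) ^ 2 * ∑ u, ψ k u ^ 2) := by
    simp_rw [hid]
    rw [h'.sum_sq_dotProduct hn hdp']
    refine le_trans (Finset.sum_le_sum fun u _ => mul_le_mul_of_nonneg_right
      (inv_anti₀ hd₀ (hd' u)) (sq_nonneg _)) ?_
    rw [← Finset.mul_sum]
    exact mul_le_mul_of_nonneg_left hyb (by positivity)
  have hstrict : (2 * c / d₀) ^ 2 * ∑ j, a j ^ 2 < ∑ j, ((lam' j - lam k) * a j) ^ 2 := by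
    rw [Finset.mul_sum]
    have hsq : ∀ j, (2 * c / d₀) ^ 2 < (lam' j - lam k) ^ 2 := fun j => by
      rw [← sq_abs (lam' j - lam k)]
      exact pow_lt_pow_left₀ (hcon j) (by positivity) two_ne_zero
    refine Finset.sum_lt_sum (fun j _ => ?_) ?_
    · rw [mul_pow]; exact mul_le_mul_of_nonneg_right (hsq j).le (sq_nonneg _)
    · obtain ⟨j, hj, hj'⟩ : ∃ j ∈ Finset.univ, 0 < a j ^ 2 := by
        by_contra! h0
        exact absurd hapos (not_lt.2 (Finset.sum_nonpos h0))
      exact ⟨j, hj, by rw [mul_pow]; exact mul_lt_mul_of_pos_right (hsq j) hj'⟩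
  have hle : d₀⁻¹ * ((2 * c) ^ 2 * ∑ u, ψ k u ^ 2) ≤ (2 * c / d₀) ^ 2 * ∑ j, a j ^ 2 := by
    refine le_trans (le_of_eq ?_) (mul_le_mul_of_nonneg_left hlow (sq_nonneg _))
    field_simp
  linarith

/-- A block of the cross kernel of two eigensystems, at a point of the diagonal. -/
theorem abs_cross_sum_le {N : Matrix V V ℝ} {J I : Finset (Fin n)} {a : Fin n → Fin n → ℝ}
    {g p q s : ℝ} (hg : 0 < g) (hp : 0 ≤ p)
    (ha : ∀ j ∈ J, ∀ k ∈ I, g * |a j k| ≤ ∑ u, ∑ v, N u v * (|φ j u| * |ψ k v|))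
    (hN0 : ∀ u v, 0 ≤ N u v) (hN : ∑ u, ∑ v, N u v ≤ s)
    (hφ : ∀ x, embNorm φ J x ≤ p) (hψ : ∀ x, embNorm ψ I x ≤ q) (x : V) :
    |∑ j ∈ J, ∑ k ∈ I, a j k * φ j x * ψ k x| ≤ s * (p * q) / g := by
  -- By AM-GM the off-diagonal values of the absolute kernel are controlled by its diagonal, which
  -- is the embedding norm.
  have hker : ∀ {f : Fin n → V → ℝ} {T : Finset (Fin n)} {m : ℝ},
      (∀ x, embNorm f T x ≤ m) → ∀ u, ∑ j ∈ T, |f j x| * |f j u| ≤ m := by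
    intro f T m hm u
    have h1 : ∑ j ∈ T, |f j x| * |f j u| ≤ (embNorm f T x + embNorm f T u) / 2 := by
      rw [embNorm, embNorm, ← Finset.sum_add_distrib, Finset.sum_div]
      refine Finset.sum_le_sum fun j _ => ?_
      have := two_mul_le_add_sq |f j x| |f j u|
      rw [sq_abs, sq_abs] at this
      linarith
    linarith [hm x, hm u]
  have hq : 0 ≤ q := le_trans (Finset.sum_nonneg fun k _ => sq_nonneg _) (hψ x)
  rw [le_div_iff₀ hg]
  calc |∑ j ∈ J, ∑ k ∈ I, a j k * φ j x * ψ k x| * g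
      ≤ (∑ j ∈ J, ∑ k ∈ I, |a j k * φ j x * ψ k x|) * g := by
        refine mul_le_mul_of_nonneg_right ?_ hg.le
        exact (Finset.abs_sum_le_sum_abs _ _).trans
          (Finset.sum_le_sum fun j _ => Finset.abs_sum_le_sum_abs _ _)
    _ = ∑ j ∈ J, ∑ k ∈ I, (g * |a j k|) * (|φ j x| * |ψ k x|) := by
        simp_rw [Finset.sum_mul, abs_mul]
        exact Finset.sum_congr rfl fun j _ => Finset.sum_congr rfl fun k _ => by ring
    _ ≤ ∑ j ∈ J, ∑ k ∈ I, (∑ u, ∑ v, N u v * (|φ j u| * |ψ k v|)) * (|φ j x| * |ψ k x|) :=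
        Finset.sum_le_sum fun j hj => Finset.sum_le_sum fun k hk =>
          mul_le_mul_of_nonneg_right (ha j hj k hk) (by positivity)
    _ = ∑ u, ∑ v, N u v * ((∑ j ∈ J, |φ j x| * |φ j u|) * ∑ k ∈ I, |ψ k x| * |ψ k v|) := by
        simp_rw [Finset.sum_mul_sum, Finset.mul_sum, Finset.sum_mul]
        simp_rw [Finset.sum_comm (s := I) (t := Finset.univ)]
        rw [Finset.sum_comm]
        refine Finset.sum_congr rfl fun u _ => ?_
        rw [Finset.sum_comm]
        exact Finset.sum_congr rfl fun v _ => Finset.sum_congr rfl fun j _ =>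
          Finset.sum_congr rfl fun k _ => by ring
    _ ≤ ∑ u, ∑ v, N u v * (p * q) :=
        Finset.sum_le_sum fun u _ => Finset.sum_le_sum fun v _ =>
          mul_le_mul_of_nonneg_left (mul_le_mul (hker hφ u) (hker hψ v)
            (Finset.sum_nonneg fun k _ => by positivity) hp) (hN0 u v)
    _ = (∑ u, ∑ v, N u v) * (p * q) := by simp_rw [Finset.sum_mul]
    _ ≤ s * (p * q) := mul_le_mul_of_nonneg_right hN (mul_nonneg hp hq)

/-- The kernel of the degree perturbation between the two spectral projections. -/
theorem abs_degree_sum_le {r : V → ℝ} {I : Finset (Fin n)}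
    (h : IsEigenSystem A lam ψ) (h' : IsEigenSystem A' lam' φ) {d₀ c : ℝ} (hd₀ : 0 < d₀)
    (hd : ∀ x, d₀ ≤ degree A x) (hd' : ∀ x, d₀ ≤ degree A' x) (hr : ∀ x, |r x| ≤ c) (x : V) :
    |∑ u, r u * (∑ j ∈ I, φ j x * φ j u) * (∑ k ∈ I, ψ k x * ψ k u)| ≤
      c / d₀ * ((embNorm φ I x + embNorm ψ I x) / 2) := by
  rw [← h.sum_degree_mul_kernel_sq, ← h'.sum_degree_mul_kernel_sq, ← Finset.sum_add_distrib,
    Finset.sum_div, Finset.mul_sum]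
  refine (Finset.abs_sum_le_sum_abs _ _).trans (Finset.sum_le_sum fun u _ => ?_)
  set a := ∑ j ∈ I, φ j x * φ j u
  set b := ∑ k ∈ I, ψ k x * ψ k u
  have hc : 0 ≤ c := (abs_nonneg _).trans (hr u)
  calc |r u * a * b| = |r u| * (|a| * |b|) := by rw [abs_mul, abs_mul, mul_assoc]
    _ ≤ c * ((a ^ 2 + b ^ 2) / 2) := by
        refine mul_le_mul (hr u) ?_ (by positivity) hc
        have := two_mul_le_add_sq |a| |b|
        rw [sq_abs, sq_abs] at this
        linarith
    _ = c / d₀ * ((d₀ * a ^ 2 + d₀ * b ^ 2) / 2) := by field_simp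
    _ ≤ _ := by
        have h1 := mul_le_mul_of_nonneg_right (hd' u) (sq_nonneg a)
        have h2 := mul_le_mul_of_nonneg_right (hd u) (sq_nonneg b)
        gcongr

/-- Expand `φ` in the basis `ψ` and `ψ` in the basis `φ`. The two `I × I` blocks pair the same
vectors with weights `D` and `D'`, so their difference only sees `D' - D`. -/
theorem embNorm_sub_eq (hn : Fintype.card V = n)
    (h : IsEigenSystem A lam ψ) (h' : IsEigenSystem A' lam' φ)
    (hd : ∀ x, 0 < degree A x) (hd' : ∀ x, 0 < degree A' x) (I : Finset (Fin n)) (x : V) :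
    embNorm φ I x - embNorm ψ I x =
      ∑ k ∈ Iᶜ, ∑ j ∈ I, (∑ u, degree A u * ψ k u * φ j u) * ψ k x * φ j x -
      ∑ j ∈ Iᶜ, ∑ k ∈ I, (∑ u, degree A' u * φ j u * ψ k u) * φ j x * ψ k x -
      ∑ u, degree (A' - A) u * (∑ j ∈ I, φ j x * φ j u) * (∑ k ∈ I, ψ k x * ψ k u) := by
  have expand : ∀ {B : Matrix V V ℝ} {μ : Fin n → ℝ} {f g : Fin n → V → ℝ},
      IsEigenSystem B μ f → (∀ x, 0 < degree B x) → embNorm g I x =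
      ∑ k ∈ I, ∑ j ∈ I, (∑ u, degree B u * f k u * g j u) * f k x * g j x +
      ∑ k ∈ Iᶜ, ∑ j ∈ I, (∑ u, degree B u * f k u * g j u) * f k x * g j x := by
    intro B μ f g hf hB
    rw [Finset.sum_add_sum_compl, Finset.sum_comm, embNorm]
    refine Finset.sum_congr rfl fun j _ => ?_
    rw [← Finset.sum_mul, hf.sum_coeff_mul hn hB, sq]
  have hlast : ∑ u, degree (A' - A) u * (∑ j ∈ I, φ j x * φ j u) * (∑ k ∈ I, ψ k x * ψ k u) =
      ∑ j ∈ I, ∑ k ∈ I, (∑ u, degree A' u * φ j u * ψ k u) * φ j x * ψ k x -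
      ∑ k ∈ I, ∑ j ∈ I, (∑ u, degree A u * ψ k u * φ j u) * ψ k x * φ j x := by
    rw [Finset.sum_comm (s := I) (t := I) (f := fun k j =>
      (∑ u, degree A u * ψ k u * φ j u) * ψ k x * φ j x), ← Finset.sum_sub_distrib]
    simp_rw [← Finset.sum_sub_distrib, Finset.sum_mul, ← Finset.sum_sub_distrib, mul_assoc,
      Finset.sum_mul_sum, Finset.mul_sum]
    rw [Finset.sum_comm]
    refine Finset.sum_congr rfl fun j _ => ?_
    rw [Finset.sum_comm]
    refine Finset.sum_congr rfl fun k _ => Finset.sum_congr rfl fun u _ => ?_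
    rw [degree_sub]; ring
  rw [hlast, expand h hd, expand h' hd' (g := ψ)]
  ring

/-- A finite difference bound for the embedding norm, with no regularity of eigenvectors. -/
theorem abs_embNorm_sub_le (hn : Fintype.card V = n) (hA : A.IsSymm) (hA' : A'.IsSymm)
    (hR : ∀ u v, |(A' - A) u v| ≤ E u v)
    (h : IsEigenSystem A lam ψ) (h' : IsEigenSystem A' lam' φ) {d₀ c g m m' : ℝ} (hd₀ : 0 < d₀)
    (hd : ∀ x, d₀ ≤ degree A x) (hd' : ∀ x, d₀ ≤ degree A' x)
    (hl : ∀ k, |lam k| ≤ 1) (hl' : ∀ k, |lam' k| ≤ 1)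
    (hc : ∀ x, degree E x ≤ c) (hEc : ∑ x, degree E x ≤ 2 * c)
    (hg : 0 < g) {I : Finset (Fin n)} (hgap : ∀ i ∈ I, ∀ j ∈ Iᶜ, g ≤ |lam' j - lam i|)
    (hgap' : ∀ i ∈ I, ∀ j ∈ Iᶜ, g ≤ |lam' i - lam j|)
    (hm : ∀ x, embNorm ψ I x ≤ m) (hm' : ∀ x, embNorm φ I x ≤ m') (x : V) :
    |embNorm φ I x - embNorm ψ I x| ≤ c / d₀ * (4 / g + 1 / 2) * (m + m') := by
  have hdp : ∀ x, 0 < degree A x := fun x => hd₀.trans_le (hd x)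
  have hdp' : ∀ x, 0 < degree A' x := fun x => hd₀.trans_le (hd' x)
  have hE0 : ∀ u v, 0 ≤ E u v := fun u v => (abs_nonneg _).trans (hR u v)
  have hdE : ∀ u, 0 ≤ degree E u := fun u => Finset.sum_nonneg fun v _ => hE0 u v
  have hc0 : 0 ≤ c := (hdE x).trans (hc x)
  have hN0 : ∀ u v, 0 ≤ envelope E u v := fun u v => by
    refine add_nonneg (hE0 u v) ?_
    by_cases huv : u = v
    · subst huv; simpa [degreeMatrix] using hdE u
    · simp [degreeMatrix, huv]
  have hN : ∑ u, ∑ v, envelope E u v ≤ 4 * c := by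
    simp_rw [envelope_row, ← Finset.mul_sum]
    linarith
  have hbound : ∀ {R : Matrix V V ℝ} {l : ℝ} (f f' : V → ℝ), (∀ u v, |R u v| ≤ E u v) →
      |l| ≤ 1 → |∑ u, f u * ∑ v, (R - l • degreeMatrix R) u v * f' v| ≤
        ∑ u, ∑ v, envelope E u v * (|f u| * |f' v|) := by
    intro R l f f' hR hl
    simp_rw [Finset.mul_sum]
    refine (Finset.abs_sum_le_sum_abs _ _).trans (Finset.sum_le_sum fun u _ => ?_)
    refine (Finset.abs_sum_le_sum_abs _ _).trans (Finset.sum_le_sum fun v _ => ?_)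
    rw [abs_mul, abs_mul, mul_left_comm]
    exact mul_le_mul_of_nonneg_right (abs_pencil_le hR hl u v) (by positivity)
  have hR' : ∀ u v, |(A - A') u v| ≤ E u v := fun u v => by
    rw [Matrix.sub_apply, abs_sub_comm]; exact hR u v
  -- The indices in `Iᶜ` get only the universal bound `1/d₀`; those in `I` keep the maximum of `S`,
  -- so the final estimate is linear in `m + m'`.
  have t1 := abs_cross_sum_le (φ := ψ) (ψ := φ) (J := Iᶜ) (I := I)
    (a := fun k j => ∑ u, degree A u * ψ k u * φ j u) (p := d₀⁻¹) (q := m') hg (by positivity)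
    (fun k hk j hj => by
      refine le_trans ?_ (hbound (ψ k) (φ j) hR' (hl' j))
      rw [← cross_identity hA h' h hdp' hdp k j, abs_mul, abs_sub_comm]
      exact mul_le_mul_of_nonneg_right (hgap' j hj k hk) (abs_nonneg _)) hN0 hN
    (fun y => (h.embNorm_le hn hdp _ y).trans (inv_anti₀ hd₀ (hd y))) hm' x
  have t2 := abs_cross_sum_le (φ := φ) (ψ := ψ) (J := Iᶜ) (I := I)
    (a := fun j k => ∑ u, degree A' u * φ j u * ψ k u) (p := d₀⁻¹) (q := m) hg (by positivity)
    (fun j hj k hk => by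
      refine le_trans ?_ (hbound (φ j) (ψ k) hR (hl k))
      rw [← cross_identity hA' h h' hdp hdp' j k, abs_mul]
      exact mul_le_mul_of_nonneg_right (hgap k hk j hj) (abs_nonneg _)) hN0 hN
    (fun y => (h'.embNorm_le hn hdp' _ y).trans (inv_anti₀ hd₀ (hd' y))) hm x
  have t3 := abs_degree_sum_le (I := I) h h' hd₀ hd hd' (r := degree (A' - A)) (c := c)
    (fun u => ((Finset.abs_sum_le_sum_abs _ _).trans
      (Finset.sum_le_sum fun v _ => hR u v)).trans (hc u)) x
  have t4 : c / d₀ * ((embNorm φ I x + embNorm ψ I x) / 2) ≤ c / d₀ * ((m' + m) / 2) := by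
    have := hm x
    have := hm' x
    gcongr
  rw [embNorm_sub_eq hn h h' hdp hdp']
  refine (abs_sub _ _).trans ((add_le_add ((abs_sub _ _).trans (add_le_add t1 t2))
    (t3.trans t4)).trans (le_of_eq ?_))
  field_simp
  ring

end Perturbation

/-! ### Entries and degrees of the deformed graph. -/

section Deformation

variable {W : Matrix V V ℝ} {B C : Finset V}

theorem blockPart_isSymm (hW : W.IsSymm) : (blockPart W B C).IsSymm := by
  refine Matrix.IsSymm.ext fun x y => ?_
  simp only [blockPart, Matrix.of_apply, hW.apply]
  congr 1
  exact propext (by tauto)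

theorem deform_isSymm (hW : W.IsSymm) (t : ℝ) : (deform W B C t).IsSymm :=
  (blockPart_isSymm hW).add ((hW.sub (blockPart_isSymm hW)).smul t)

theorem deform_sub_deform_zero (t : ℝ) :
    deform W B C t - deform W B C 0 = t • (W - blockPart W B C) := by
  simp [deform]

theorem blockPart_nonneg (hW : ∀ x y, 0 ≤ W x y) (x y : V) : 0 ≤ blockPart W B C x y := by
  simp only [blockPart, Matrix.of_apply]
  split_ifs
  · exact le_rfl
  · exact hW x y

theorem sub_blockPart_apply (x y : V) : (W - blockPart W B C) x y =
    if (x ∈ B ∧ y ∈ C) ∨ (x ∈ C ∧ y ∈ B) then W x y else 0 := by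
  simp only [blockPart, Matrix.of_apply, Matrix.sub_apply]
  split_ifs <;> simp

theorem sub_blockPart_nonneg (hW : ∀ x y, 0 ≤ W x y) (x y : V) :
    0 ≤ (W - blockPart W B C) x y := by
  rw [sub_blockPart_apply]
  split_ifs
  · exact hW x y
  · exact le_rfl

theorem deform_nonneg (hW : ∀ x y, 0 ≤ W x y) {t : ℝ} (ht : 0 ≤ t) (x y : V) :
    0 ≤ deform W B C t x y :=
  add_nonneg (blockPart_nonneg hW x y) (mul_nonneg ht (sub_blockPart_nonneg hW x y))

theorem abs_deform_sub_le (hW : ∀ x y, 0 ≤ W x y) {t : ℝ} (ht : t ∈ Set.Icc (0 : ℝ) 1)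
    (x y : V) : |(deform W B C t - deform W B C 0) x y| ≤ (W - blockPart W B C) x y := by
  have h := sub_blockPart_nonneg (B := B) (C := C) hW x y
  rw [deform_sub_deform_zero, Matrix.smul_apply, smul_eq_mul, abs_of_nonneg (mul_nonneg ht.1 h)]
  exact mul_le_of_le_one_left h ht.2

theorem minDegree_le_degree_deform (hW : ∀ x y, 0 ≤ W x y) {t : ℝ} (ht : 0 ≤ t) (x : V) :
    minDegree (deform W B C 0) ≤ degree (deform W B C t) x := by
  refine (minDegree_le _ x).trans (Finset.sum_le_sum fun y _ => ?_)
  have : 0 ≤ (deform W B C t - deform W B C 0) x y := by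
    rw [deform_sub_deform_zero]
    exact mul_nonneg ht (sub_blockPart_nonneg hW x y)
  exact sub_nonneg.1 this

theorem degree_cross_of_mem_left (hdisj : Disjoint B C) {x : V} (hx : x ∈ B) :
    degree (W - blockPart W B C) x = ∑ y ∈ C, W x y := by
  have hx' : x ∉ C := Finset.disjoint_left.1 hdisj hx
  simp only [degree, sub_blockPart_apply]
  simp [hx, hx']

theorem degree_cross_of_mem_right (hdisj : Disjoint B C) {x : V} (hx : x ∈ C) :
    degree (W - blockPart W B C) x = ∑ y ∈ B, W x y := by
  have hx' : x ∉ B := Finset.disjoint_right.1 hdisj hx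
  simp only [degree, sub_blockPart_apply]
  simp [hx, hx']

theorem connection_eq_sum_right (hW : W.IsSymm) :
    connection W B C = ∑ x ∈ C, ∑ y ∈ B, W x y := by
  refine Finset.sum_comm.trans ?_
  exact Finset.sum_congr rfl fun x _ => Finset.sum_congr rfl fun y _ => hW.apply x y

theorem degree_cross_le (hsymm : W.IsSymm) (hW : ∀ x y, 0 ≤ W x y) (hdisj : Disjoint B C)
    (hunion : B ∪ C = Finset.univ) (x : V) :
    degree (W - blockPart W B C) x ≤ connection W B C := by
  have hx : x ∈ B ∪ C := hunion ▸ Finset.mem_univ x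
  rcases Finset.mem_union.1 hx with hx | hx
  · rw [degree_cross_of_mem_left hdisj hx]
    exact Finset.single_le_sum (f := fun x => ∑ y ∈ C, W x y)
      (fun x _ => Finset.sum_nonneg fun y _ => hW x y) hx
  · rw [degree_cross_of_mem_right hdisj hx, connection_eq_sum_right hsymm]
    exact Finset.single_le_sum (f := fun x => ∑ y ∈ B, W x y)
      (fun x _ => Finset.sum_nonneg fun y _ => hW x y) hx

theorem sum_degree_cross (hsymm : W.IsSymm) (hdisj : Disjoint B C)
    (hunion : B ∪ C = Finset.univ) :
    ∑ x, degree (W - blockPart W B C) x = 2 * connection W B C := by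
  rw [← hunion, Finset.sum_union hdisj, two_mul]
  congr 1
  · exact Finset.sum_congr rfl fun x hx => degree_cross_of_mem_left hdisj hx
  · rw [connection_eq_sum_right hsymm]
    exact Finset.sum_congr rfl fun x hx => degree_cross_of_mem_right hdisj hx

end Deformation

/-! ### Persistence of the spectral gap, and orthogonal invariance. -/

/-- Continuous branches that stay within `r` of a set of initial values that splits into two
separated groups do not leave their group. -/
theorem gap_of_near_initial {lam : ℝ → Fin n → ℝ}
    (hlam : ∀ k, ContinuousOn (fun t => lam t k) (Set.Icc (0 : ℝ) 1)) {r D : ℝ} (hr : r < D)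
    (hnear : ∀ t ∈ Set.Icc (0 : ℝ) 1, ∀ k, ∃ j, |lam 0 j - lam t k| ≤ r) {I J : Finset (Fin n)}
    (hIJ : ∀ k, k ∈ I ∨ k ∈ J) (hgap : ∀ i ∈ I, ∀ j ∈ J, 2 * D ≤ |lam 0 i - lam 0 j|)
    {t : ℝ} (ht : t ∈ Set.Icc (0 : ℝ) 1) {i j : Fin n} (hi : i ∈ I) (hj : j ∈ J) :
    2 * D - r ≤ |lam t i - lam 0 j| := by
  have h0 : (0 : ℝ) ∈ Set.Icc (0 : ℝ) 1 := by simp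
  have hr0 : 0 ≤ r := let ⟨_, h⟩ := hnear 0 h0 i; (abs_nonneg _).trans h
  let U : Finset (Fin n) → Set ℝ := fun T => ⋃ k ∈ T, Metric.ball (lam 0 k) D
  have hU : ∀ T, IsOpen (U T) := fun T => isOpen_biUnion fun k _ => Metric.isOpen_ball
  have hmem : ∀ {T : Finset (Fin n)} {z : ℝ}, z ∈ U T ↔ ∃ k ∈ T, |lam 0 k - z| < D := by
    intro T z
    simp only [U, Set.mem_iUnion, Metric.mem_ball, Real.dist_eq, exists_prop, abs_sub_comm z]
  have hfar : ∀ {z : ℝ} {k l : Fin n}, k ∈ I → l ∈ J → |lam 0 k - z| < D →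
      |lam 0 l - z| < D → False := by
    intro z k l hk hl h1 h2
    have := abs_sub_le (lam 0 k) z (lam 0 l)
    rw [abs_sub_comm z] at this
    linarith [hgap k hk l hl]
  have hpre : IsPreconnected ((fun s => lam s i) '' Set.Icc (0 : ℝ) 1) :=
    isPreconnected_Icc.image _ (hlam i)
  -- The connected image of the branch lies in two disjoint open sets and starts in the first.
  have hsub : (fun s => lam s i) '' Set.Icc (0 : ℝ) 1 ⊆ U I := by
    refine hpre.subset_left_of_subset_union (hU I) (hU J) ?_ ?_ ?_
    · refine Set.disjoint_left.2 fun z hz hz' => ?_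
      obtain ⟨k, hk, h1⟩ := hmem.1 hz
      obtain ⟨l, hl, h2⟩ := hmem.1 hz'
      exact hfar hk hl h1 h2
    · rintro _ ⟨s, hs, rfl⟩
      obtain ⟨k, hk⟩ := hnear s hs i
      rcases hIJ k with h | h
      · exact Or.inl (hmem.2 ⟨k, h, hk.trans_lt hr⟩)
      · exact Or.inr (hmem.2 ⟨k, h, hk.trans_lt hr⟩)
    · exact ⟨lam 0 i, ⟨0, h0, rfl⟩, hmem.2 ⟨i, hi, by simpa using hr0.trans_lt hr⟩⟩
  obtain ⟨k, hk, h1⟩ := hmem.1 (hsub ⟨t, ht, rfl⟩)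
  obtain ⟨l, hl⟩ := hnear t ht i
  rcases hIJ l with h | h
  -- An initial value within `r`, not merely within `D`, belongs to the same group; this gives `2 *
  -- D - r`.
  · have := abs_sub_le (lam 0 l) (lam t i) (lam 0 j)
    linarith [hgap l h j hj]
  · exact (hfar hk h h1 (hl.trans_lt hr)).elim

theorem le_abs_sub_of_le_eigenGap {lam : Fin n → ℝ} {I : Finset (Fin n)} {g : ℝ}
    (h : (g : EReal) ≤ eigenGap lam I) {i j : Fin n} (hi : i ∈ I) (hj : j ∈ Iᶜ) :
    g ≤ |lam i - lam j| := by
  have : eigenGap lam I ≤ ((|lam i - lam j| : ℝ) : EReal) :=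
    (iInf₂_le i hi).trans (iInf₂_le j hj)
  exact EReal.coe_le_coe_iff.1 (h.trans this)

theorem sum_sq_orthogonal {K : ℕ} {Q : Matrix (Fin K) (Fin K) ℝ}
    (hQ : Q ∈ Matrix.orthogonalGroup (Fin K) ℝ) (v : Fin K → ℝ) :
    ∑ j, (∑ i, Q j i * v i) ^ 2 = ∑ i, v i ^ 2 := by
  have h1 : Q.transpose * Q = 1 := (Matrix.mem_orthogonalGroup_iff' _ _).1 hQ
  have h2 : Q.mulVec v ⬝ᵥ Q.mulVec v = v ⬝ᵥ v := by
    rw [Matrix.dotProduct_mulVec, Matrix.vecMul_mulVec, h1, Matrix.vecMul_one]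
  simpa [dotProduct, Matrix.mulVec, sq] using h2

/-! ### The embedding norm of the decoupled graph. -/

section Initial

variable {W₀ : Matrix V V ℝ} {B C : Finset V} {K : ℕ} {Cl : Fin K → Finset V}
  {lam : Fin n → ℝ} {ψ : Fin n → V → ℝ} {I : Finset (Fin n)} {ε₁ ε₂ : ℝ}

/-- A vector supported on both sides would vanish, against normalization. So the two index sets are
disjoint, and by the counts they exhaust `I`. -/
theorem embNorm_eq_add (hdisj : Disjoint B C) (h : IsEigenSystem W₀ lam ψ)
    (hA : EigenvectorAssumption W₀ B C Cl ψ I ε₁ ε₂) (x : V) :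
    embNorm ψ I x = ∑ k ∈ (supportedIndices ψ I C).toFinite.toFinset, ψ k x ^ 2 +
      ∑ k ∈ (supportedIndices ψ I B).toFinite.toFinset, ψ k x ^ 2 := by
  have hd : Disjoint (supportedIndices ψ I C).toFinite.toFinset
      (supportedIndices ψ I B).toFinite.toFinset := by
    refine Finset.disjoint_left.2 fun k hk hk' => ?_
    rw [Set.Finite.mem_toFinset] at hk hk'
    have h0 : ∀ x, ψ k x = 0 := fun x => by
      by_cases hx : x ∈ B
      · exact hk.2 x (Finset.disjoint_left.1 hdisj hx)
      · exact hk'.2 x hx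
    have := h.sum_degree_mul k k
    simp [h0] at this
  rw [← Finset.sum_union hd, embNorm]
  refine Finset.sum_congr (Eq.symm (Finset.eq_of_subset_of_card_le ?_ ?_)) fun _ _ => rfl
  · intro k hk
    rcases Finset.mem_union.1 hk with hk | hk
    · exact ((Set.Finite.mem_toFinset _).1 hk).1
    · exact ((Set.Finite.mem_toFinset _).1 hk).1
  · rw [Finset.card_union_of_disjoint hd, ← Set.ncard_eq_toFinset_card,
      ← Set.ncard_eq_toFinset_card, hA.count_C, ← hA.count_B, add_comm]

theorem embNorm_of_mem_left (hdisj : Disjoint B C) (h : IsEigenSystem W₀ lam ψ)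
    (hA : EigenvectorAssumption W₀ B C Cl ψ I ε₁ ε₂) {x : V} (hx : x ∈ B) :
    embNorm ψ I x ≤ ((I.card : ℝ) - K) * ((1 + ε₂) / vol W₀ B) := by
  have h0 : ∑ k ∈ (supportedIndices ψ I C).toFinite.toFinset, ψ k x ^ 2 = 0 :=
    Finset.sum_eq_zero fun k hk => by
      rw [((Set.Finite.mem_toFinset _).1 hk).2 x (Finset.disjoint_left.1 hdisj hx)]; ring
  rw [embNorm_eq_add hdisj h hA, h0, zero_add]
  refine (Finset.sum_le_card_nsmul _ _ _ fun k hk =>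
    hA.flat k ((Set.Finite.mem_toFinset _).1 hk) x hx).trans (le_of_eq ?_)
  rw [← Set.ncard_eq_toFinset_card, nsmul_eq_mul, ← hA.count_B]
  push_cast
  ring

/-- A sum of squares is unchanged by `Q`, so the rotated vectors may be used: one is large at `x`,
the other `K - 1` are small. -/
theorem embNorm_of_mem_right (hsplit : IsSplitting B C Cl) (h : IsEigenSystem W₀ lam ψ)
    (hA : EigenvectorAssumption W₀ B C Cl ψ I ε₁ ε₂) {x : V} (hx : x ∈ C) :
    ∃ j, (1 - ε₁) / vol W₀ (Cl j) ≤ embNorm ψ I x ∧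
      embNorm ψ I x ≤ (1 + ε₁) / vol W₀ (Cl j) + K * (ε₁ / vol W₀ C) - ε₁ / vol W₀ C := by
  obtain ⟨e, Q, hQ, hcl⟩ := hA.clustered
  have h0 : ∑ k ∈ (supportedIndices ψ I B).toFinite.toFinset, ψ k x ^ 2 = 0 :=
    Finset.sum_eq_zero fun k hk => by
      rw [((Set.Finite.mem_toFinset _).1 hk).2 x (Finset.disjoint_right.1 hsplit.disjoint hx)]
      ring
  have h1 : ∑ k ∈ (supportedIndices ψ I C).toFinite.toFinset, ψ k x ^ 2 =
      ∑ i, ψ (e i) x ^ 2 := by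
    symm
    refine Finset.sum_bij (fun i _ => (e i : Fin n)) (fun i _ => by simp)
      (fun i _ i' _ hii => e.injective (Subtype.ext hii)) (fun k hk => ?_) (fun _ _ => rfl)
    have hk' := (Set.Finite.mem_toFinset _).1 hk
    exact ⟨e.symm ⟨k, hk'⟩, Finset.mem_univ _, by simp⟩
  have hS : embNorm ψ I x = ∑ j, (∑ i, Q j i * ψ (e i) x) ^ 2 := by
    rw [embNorm_eq_add hsplit.disjoint h hA, h0, add_zero, h1, sum_sq_orthogonal hQ]
  obtain ⟨j, -, hj⟩ := Finset.mem_biUnion.1 (hsplit.cluster_union ▸ hx)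
  refine ⟨j, ?_, ?_⟩
  · rw [hS]
    exact ((hcl j).1 x hj).1.trans (Finset.single_le_sum
      (f := fun j => (∑ i, Q j i * ψ (e i) x) ^ 2) (fun _ _ => sq_nonneg _) (Finset.mem_univ j))
  · rw [hS, ← Finset.add_sum_erase _ _ (Finset.mem_univ j), add_sub_assoc]
    refine add_le_add ((hcl j).1 x hj).2 ?_
    refine (Finset.sum_le_card_nsmul _ _ (ε₁ / vol W₀ C) fun i hi => ?_).trans (le_of_eq ?_)
    · refine (hcl i).2 x (Finset.mem_sdiff.2 ⟨hx, fun hxi => ?_⟩)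
      exact Finset.disjoint_left.1 (hsplit.cluster_disjoint i j (Finset.ne_of_mem_erase hi)) hxi hj
    · have hK : 1 ≤ K := by have := j.2; omega
      rw [Finset.card_erase_of_mem (Finset.mem_univ j), nsmul_eq_mul, Finset.card_univ,
        Fintype.card_fin, Nat.cast_sub hK]
      push_cast
      ring

theorem mul_card_le_vol (A : Finset V) : A.card * minDegree W₀ ≤ vol W₀ A := by
  rw [vol, ← nsmul_eq_mul]
  exact Finset.card_nsmul_le_sum _ _ _ fun x _ => minDegree_le W₀ x

theorem vol_le_mul_card (A : Finset V) : vol W₀ A ≤ A.card * maxDegree W₀ := by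
  rw [vol, ← nsmul_eq_mul]
  exact Finset.sum_le_card_nsmul _ _ _ fun x _ => le_maxDegree W₀ x

end Initial

/-- The decoupled embedding norm is large on `C` and small on `B`. -/
theorem initial_embNorm_bounds {W₀ : Matrix V V ℝ} {B C : Finset V} (hB : B.Nonempty) {K : ℕ}
    (hK : 0 < K) {Cl : Fin K → Finset V} {lam : Fin n → ℝ} {ψ : Fin n → V → ℝ}
    {I : Finset (Fin n)} {ε₁ ε₂ : ℝ} (hsplit : IsSplitting B C Cl) (hd : 0 < minDegree W₀)
    (h : IsEigenSystem W₀ lam ψ) (hA : EigenvectorAssumption W₀ B C Cl ψ I ε₁ ε₂) :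
    ∃ M : ℝ, 0 < M ∧
      (∀ x ∈ C, M * (minDegree W₀ * (1 - ε₁) / maxDegree W₀) ≤ embNorm ψ I x ∧
        embNorm ψ I x ≤ M * (1 + 2 * ε₁)) ∧
      ∀ x ∈ B, embNorm ψ I x ≤
        M * (fraction C / (1 - fraction C) * (((I.card : ℝ) - K) / K) * (1 + ε₂)) := by
  have hC : C.Nonempty := by
    by_contra hC
    rw [Finset.not_nonempty_iff_eq_empty] at hC
    have : supportedIndices ψ I C = ∅ := by
      refine Set.eq_empty_of_forall_notMem fun k hk => ?_
      have h1 := h.sum_degree_mul k k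
      have h0 : ∀ x, ψ k x = 0 := fun x => hk.2 x (by simp [hC])
      simp [h0] at h1
    have h2 := hA.count_C
    rw [this, Set.ncard_empty] at h2
    omega
  have hcB : (0 : ℝ) < B.card := by exact_mod_cast hB.card_pos
  have hcC : (0 : ℝ) < C.card := by exact_mod_cast hC.card_pos
  have hKR : (0 : ℝ) < K := by exact_mod_cast hK
  have hε₁ := hA.eps₁_nonneg
  have hε₁' := hA.eps₁_lt_one
  have hε₂ := hA.eps₂_nonneg
  have hm : (0 : ℝ) ≤ (I.card : ℝ) - K := by
    rw [← hA.count_B]; push_cast; linarith [Nat.cast_nonneg (α := ℝ) (supportedIndices ψ I B).ncard]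
  obtain ⟨b, -⟩ := hB
  have hmax : 0 < maxDegree W₀ := hd.trans_le ((minDegree_le W₀ b).trans (le_maxDegree W₀ b))
  have hfrac : fraction C / (1 - fraction C) = C.card / B.card := by
    have hN : (Fintype.card V : ℝ) = B.card + C.card := by
      rw [← Finset.card_univ, ← hsplit.union, Finset.card_union_of_disjoint hsplit.disjoint]
      push_cast; ring
    have h1 : 1 - (C.card : ℝ) / (B.card + C.card) = B.card / (B.card + C.card) := by
      rw [eq_div_iff (by positivity), sub_mul, div_mul_cancel₀ _ (by positivity)]
      ring
    rw [fraction, hN, h1]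
    field_simp
  -- This scale is the largest possible `1 / vol W₀ (Cl j)`, as each cluster has `|C| / K` nodes.
  refine ⟨K / (minDegree W₀ * C.card), by positivity, fun x hx => ?_, fun x hx => ?_⟩
  · obtain ⟨j, h1, h2⟩ := embNorm_of_mem_right hsplit h hA hx
    have hlow := mul_card_le_vol (W₀ := W₀) (Cl j)
    have hup := vol_le_mul_card (W₀ := W₀) (Cl j)
    have hlowC := mul_card_le_vol (W₀ := W₀) C
    rw [hsplit.cluster_card j] at hlow hup
    have hlow0 : 0 < (C.card : ℝ) / K * minDegree W₀ := by positivity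
    have hlowC0 : 0 < (C.card : ℝ) * minDegree W₀ := by positivity
    constructor
    · refine le_trans ?_ h1
      refine le_trans (le_of_eq ?_)
        (div_le_div_of_nonneg_left (by linarith) (hlow0.trans_le hlow) hup)
      field_simp
    · have e1 : (1 + ε₁) / vol W₀ (Cl j) ≤ (1 + ε₁) / ((C.card : ℝ) / K * minDegree W₀) :=
        div_le_div_of_nonneg_left (by linarith) hlow0 hlow
      have e2 : ε₁ / vol W₀ C ≤ ε₁ / ((C.card : ℝ) * minDegree W₀) :=
        div_le_div_of_nonneg_left hε₁ hlowC0 hlowC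
      have e3 : 0 ≤ ε₁ / vol W₀ C := div_nonneg hε₁ (hlowC0.le.trans hlowC)
      have e4 := mul_le_mul_of_nonneg_left e2 hKR.le
      have e5 : (1 + ε₁) / ((C.card : ℝ) / K * minDegree W₀) +
          K * (ε₁ / ((C.card : ℝ) * minDegree W₀)) =
          K / (minDegree W₀ * C.card) * (1 + 2 * ε₁) := by
        field_simp
        ring
      linarith
  · refine (embNorm_of_mem_left hsplit.disjoint h hA hx).trans ?_
    have hlow0 : 0 < (B.card : ℝ) * minDegree W₀ := by positivity
    have e1 : (1 + ε₂) / vol W₀ B ≤ (1 + ε₂) / ((B.card : ℝ) * minDegree W₀) :=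
      div_le_div_of_nonneg_left (by linarith) hlow0 (mul_card_le_vol B)
    refine (mul_le_mul_of_nonneg_left e1 hm).trans (le_of_eq ?_)
    rw [hfrac]
    field_simp

end EmbeddingNorm

/-! ### Separation at `t = 1`. -/

open EmbeddingNorm in
theorem mainTheorem1 {V : Type*} [Fintype V] [DecidableEq V]
    (n : ℕ) (hn : Fintype.card V = n)
    (W : Matrix V V ℝ) (hsymm : W.IsSymm) (hnonneg : ∀ x y, 0 ≤ W x y)
    (B C : Finset V) (hB : B.Nonempty)
    (K : ℕ) (hK : 0 < K) (Cl : Fin K → Finset V)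
    (hsplit : EmbeddingNorm.IsSplitting B C Cl)
    (hdeg : 0 < EmbeddingNorm.minDegree (EmbeddingNorm.deform W B C 0))
    (lam : ℝ → Fin n → ℝ) (ψ : ℝ → Fin n → V → ℝ)
    (hsys : ∀ t ∈ Set.Icc (0 : ℝ) 1,
      EmbeddingNorm.IsEigenSystem (EmbeddingNorm.deform W B C t) (lam t) (ψ t))
    (hlam : ∀ k, ContinuousOn (fun t => lam t k) (Set.Icc (0 : ℝ) 1))
    (I : Finset (Fin n)) (ε₁ ε₂ : ℝ)
    (hA1 : EmbeddingNorm.EigenvectorAssumption (EmbeddingNorm.deform W B C 0) B C Cl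
      (ψ 0) I ε₁ ε₂)
    (hA2 : EmbeddingNorm.ProportionAssumption (EmbeddingNorm.deform W B C 0) C K I.card ε₁ ε₂)
    (Δ : ℝ) (hΔ : 0 < Δ)
    (hgap : ((2 * Δ : ℝ) : EReal) ≤ EmbeddingNorm.eigenGap (lam 0) I)
    (hconn : EmbeddingNorm.connection W B C /
        EmbeddingNorm.minDegree (EmbeddingNorm.deform W B C 0) ≤
      Δ / 8 * (1 / (1 + Δ / 4)) *
        Real.log (1 + 1 / 2 *
          (EmbeddingNorm.sharp (EmbeddingNorm.deform W B C 0) C K I.card ε₁ ε₂ /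
            (1 + 2 * ε₁)))) :
    ∃ τ : ℝ, (∀ x ∈ C, τ < EmbeddingNorm.embNorm (ψ 1) I x) ∧
      (∀ x ∈ B, EmbeddingNorm.embNorm (ψ 1) I x < τ) := by

  have h0 : (0 : ℝ) ∈ Set.Icc (0 : ℝ) 1 := by simp
  have h1 : (1 : ℝ) ∈ Set.Icc (0 : ℝ) 1 := by simp
  set W₀ := deform W B C 0 with hW₀
  set d₀ := minDegree W₀ with hd₀
  set c := connection W B C with hc
  obtain ⟨M, hM, hMC, hMB⟩ := initial_embNorm_bounds hB hK hsplit hdeg (hsys 0 h0) hA1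
  set a := d₀ * (1 - ε₁) / maxDegree W₀ with ha
  set b := fraction C / (1 - fraction C) * (((I.card : ℝ) - K) / K) * (1 + ε₂) with hb
  set s := sharp W₀ C K I.card ε₁ ε₂ with hs
  have hsab : s = a - b := rfl
  have hε₁ := hA1.eps₁_nonneg
  have hε₁' := hA1.eps₁_lt_one
  have hε₂ := hA1.eps₂_nonneg
  obtain ⟨x₀, hx₀⟩ := id hB
  have hdmax : d₀ ≤ maxDegree W₀ := (minDegree_le W₀ x₀).trans (le_maxDegree W₀ x₀)
  have hmax : 0 < maxDegree W₀ := hdeg.trans_le hdmax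
  have ha1 : a ≤ 1 := by
    rw [ha, div_le_one hmax]
    nlinarith
  have hb0 : 0 ≤ b := by
    have := (Finset.sum_nonneg fun k _ => sq_nonneg (ψ 0 k x₀)).trans (hMB x₀ hx₀)
    exact nonneg_of_mul_nonneg_right this hM
  have hs0 : 0 < s := by
    have h2 : fraction C / (1 - fraction C) * (((I.card : ℝ) - K) / K) <
      d₀ * (1 - ε₁) / (maxDegree W₀ * (1 + ε₂)) := hA2
    have h3 : b < d₀ * (1 - ε₁) / (maxDegree W₀ * (1 + ε₂)) * (1 + ε₂) :=
      mul_lt_mul_of_pos_right h2 (by linarith)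
    have h4 : d₀ * (1 - ε₁) / (maxDegree W₀ * (1 + ε₂)) * (1 + ε₂) = a := by
      have : (1 + ε₂) ≠ 0 := by linarith
      rw [ha]; field_simp
    rw [hsab]; linarith
  set q := 1 / 2 * (s / (1 + 2 * ε₁)) with hq
  have hq0 : 0 < q := by positivity
  have hq1 : q ≤ 1 / 2 := by
    have : s / (1 + 2 * ε₁) ≤ 1 := by rw [div_le_one (by linarith)]; linarith
    linarith
  have hc0 : 0 ≤ c := Finset.sum_nonneg fun x _ => Finset.sum_nonneg fun y _ => hnonneg x y
  have hcd0 : 0 ≤ c / d₀ := by positivity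
  -- The factor `8 / Δ + 2` is the reciprocal of the one before the logarithm, and only `log (1 + q)
  -- ≤ q` is needed.
  have hκ : c / d₀ * (8 / Δ + 2) ≤ q := by
    have h2 : Real.log (1 + q) ≤ q := by
      linarith [Real.log_le_sub_one_of_pos (show 0 < 1 + q by linarith)]
    calc c / d₀ * (8 / Δ + 2)
        ≤ Δ / 8 * (1 / (1 + Δ / 4)) * Real.log (1 + q) * (8 / Δ + 2) :=
          mul_le_mul_of_nonneg_right hconn (by positivity)
      _ = Real.log (1 + q) := by
          have : 1 + Δ / 4 ≠ 0 := by positivity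
          field_simp
          ring
      _ ≤ q := h2
  have hcΔ : c / d₀ ≤ Δ / 16 := by
    have h2 : c / d₀ * (8 / Δ) ≤ 1 / 2 := by linarith
    rw [← mul_div_assoc, div_le_iff₀ hΔ] at h2
    linarith
  have hr : 2 * c / d₀ ≤ Δ / 8 := by rw [mul_div_assoc]; linarith
  have hdt : ∀ t ∈ Set.Icc (0 : ℝ) 1, ∀ x, d₀ ≤ degree (deform W B C t) x :=
    fun t ht x => minDegree_le_degree_deform hnonneg ht.1 x
  have hl : ∀ t ∈ Set.Icc (0 : ℝ) 1, ∀ k, |lam t k| ≤ 1 := fun t ht k =>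
    (hsys t ht).abs_le_one (fun x => hdeg.trans_le (hdt t ht x)) (deform_nonneg hnonneg ht.1) k
  have hE : ∀ x, degree (W - blockPart W B C) x ≤ c :=
    degree_cross_le hsymm hnonneg hsplit.disjoint hsplit.union
  have hnear : ∀ t ∈ Set.Icc (0 : ℝ) 1, ∀ k, ∃ j, |lam 0 j - lam t k| ≤ 2 * c / d₀ :=
    fun t ht k => exists_eigenvalue_near hn (deform_isSymm hsymm 0)
      (hsymm.sub (blockPart_isSymm hsymm))
      (fun u v => by
        have := abs_deform_sub_le (B := B) (C := C) hnonneg ht u v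
        rwa [Matrix.sub_apply, abs_sub_comm] at this)
      (hsys t ht) (hsys 0 h0) hdeg (hdt t ht) (hdt 0 h0) hE k (hl t ht k)
  have hgap0 : ∀ i ∈ I, ∀ j ∈ Iᶜ, 2 * Δ ≤ |lam 0 i - lam 0 j| :=
    fun i hi j hj => le_abs_sub_of_le_eigenGap hgap hi hj
  have hmem : ∀ k, k ∈ I ∨ k ∈ Iᶜ := fun k => by
    rw [Finset.mem_compl]; exact em _
  have hg1 : ∀ i ∈ I, ∀ j ∈ Iᶜ, 3 / 2 * Δ ≤ |lam 1 j - lam 0 i| := fun i hi j hj => by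
    have := gap_of_near_initial hlam (r := 2 * c / d₀) (D := Δ) (by linarith) hnear
      (fun k => (hmem k).symm) (fun j hj i hi => by rw [abs_sub_comm]; exact hgap0 i hi j hj)
      h1 hj hi
    linarith
  have hg2 : ∀ i ∈ I, ∀ j ∈ Iᶜ, 3 / 2 * Δ ≤ |lam 1 i - lam 0 j| := fun i hi j hj => by
    have := gap_of_near_initial hlam (r := 2 * c / d₀) (D := Δ) (by linarith) hnear
      hmem hgap0 h1 hi hj
    linarith
  set m := M * (1 + 2 * ε₁) with hm
  have hMa : M * b ≤ M * a := mul_le_mul_of_nonneg_left (by linarith) hM.le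
  have hMm : M * a ≤ m := mul_le_mul_of_nonneg_left (by linarith) hM.le
  have hm0 : ∀ x, embNorm (ψ 0) I x ≤ m := fun x => by
    have hx : x ∈ B ∪ C := hsplit.union ▸ Finset.mem_univ x
    rcases Finset.mem_union.1 hx with hx | hx
    · linarith [hMB x hx]
    · exact (hMC x hx).2
  obtain ⟨z, -, hz⟩ := Finset.exists_max_image Finset.univ (fun x => embNorm (ψ 1) I x)
    ⟨x₀, Finset.mem_univ _⟩
  set m' := embNorm (ψ 1) I z with hm'
  have hm'0 : 0 ≤ m' := Finset.sum_nonneg fun k _ => sq_nonneg _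
  have hmpos : 0 < m := by positivity
  have hdiff : ∀ x, |embNorm (ψ 1) I x - embNorm (ψ 0) I x| ≤ q / 3 * (m + m') := fun x => by
    refine (abs_embNorm_sub_le hn (deform_isSymm hsymm 0) (deform_isSymm hsymm 1)
      (abs_deform_sub_le hnonneg h1) (hsys 0 h0) (hsys 1 h1) hdeg (hdt 0 h0) (hdt 1 h1)
      (hl 0 h0) (hl 1 h1) hE (sum_degree_cross hsymm hsplit.disjoint hsplit.union).le
      (g := 3 / 2 * Δ) (by positivity) hg1 hg2 hm0 (fun x => hz x (Finset.mem_univ x)) x).trans ?_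
    refine mul_le_mul_of_nonneg_right ?_ (by linarith)
    -- The gap `3 / 2 * Δ` gains the factor `1 / 3`, which pays for the unknown maximum `m'` below.
    have h2 : 4 / (3 / 2 * Δ) + 1 / 2 ≤ (8 / Δ + 2) / 3 := by
      have : 4 / (3 / 2 * Δ) = 8 / Δ / 3 := by field_simp; norm_num
      linarith
    have h3 := mul_le_mul_of_nonneg_left h2 hcd0
    linarith
  -- Bootstrap: at the maximizer `z`, `m' ≤ m + (m + m') / 6` because `q ≤ 1 / 2`; solve for `m'`.
  have hsum : m + m' ≤ 12 / 5 * m := by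
    have h2 := (abs_le.1 (hdiff z)).2
    have h3 : q / 3 * (m + m') ≤ 1 / 6 * (m + m') :=
      mul_le_mul_of_nonneg_right (by linarith) (by linarith)
    linarith [hm0 z]
  have hqm : q * m = M * s / 2 := by
    have : 1 + 2 * ε₁ ≠ 0 := by linarith
    rw [hq, hm]; field_simp
  have hMs : 0 < M * s := mul_pos hM hs0
  have hMs' : M * s = M * a - M * b := by rw [hsab]; ring
  -- The change is at most `4 / 5 * (q * m)`, strictly below half of the initial margin `M * s`, so
  -- the midpoint serves as threshold.
  have hsmall : q / 3 * (m + m') < M * s / 2 := by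
    have := mul_le_mul_of_nonneg_left hsum (show 0 ≤ q / 3 by positivity)
    linarith
  refine ⟨(M * a + M * b) / 2, fun x hx => ?_, fun x hx => ?_⟩
  · linarith [(abs_le.1 (hdiff x)).1, (hMC x hx).1]
  · linarith [(abs_le.1 (hdiff x)).2, hMB x hx]
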